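/- For $p\ge 1$ let $\ell_p^m$ denote $\mathbb{R}^m$ equipped with the $\ell_p$-norm $\|x\|_p=(\sum_{i=1}^m|x_i|^p)^{1/p}$. Let $r\ge 1$ be an integer. Then there is an integer $M=M(r)$ such that for every prime power $q\ge M$ the following holds: for every integer $d\ge 2r$ there exists an integer $N=N(d)$ with $$N\le q^{2r}d^{2r-1}$$ for which there is a linear isometric embedding $\ell_2^d\hookrightarrow\ell_{2r}^N$, that is, a linear map $\iota:\mathbb{R}^d\to\mathbb{R}^N$ with $\|\iota(x)\|_{2r}=\|x\|_2$ for all $x\in\mathbb{R}^d$. In particular, for fixed $r$ and $q$, $N(d)=O(d^{2r-1})$ as $d\to\infty$. -/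

import Mathlib

open scoped ENNReal Asymptotics

/-- The classical `m`-dimensional real Banach space `ℓ_p^m`: `ℝ^m` with the `ℓ_p`-norm
(a normed space as soon as `1 ≤ p`). -/
abbrev Ell (p : ℝ≥0∞) (m : ℕ) : Type := PiLp p (fun _ : Fin m => ℝ)

/-- The exponent `2r` is at least `1` for `r ≥ 1`, so that `ℓ_{2r}^N` is a normed space. -/
theorem fact_one_le_two_mul {r : ℕ} (hr : 1 ≤ r) : Fact (1 ≤ ((2 * r : ℕ) : ℝ≥0∞)) :=
  ⟨by exact_mod_cast (by omega : 1 ≤ 2 * r)⟩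

/-- There is a (linear) isometric embedding of `ℓ_2^d` into `ℓ_{2r}^N`. -/
def EmbedsIsometrically (r : ℕ) (hr : 1 ≤ r) (d N : ℕ) : Prop :=
  haveI : Fact (1 ≤ ((2 * r : ℕ) : ℝ≥0∞)) := fact_one_le_two_mul hr
  Nonempty (Ell 2 d →ₗᵢ[ℝ] Ell ((2 * r : ℕ) : ℝ≥0∞) N)

open MeasureTheory ProbabilityTheory Filter Topology

/-- The moments of a linear form in independent standard Gaussian variables. -/
theorem integral_linearForm_pow_gaussian {ι : Type*} [Fintype ι] (x : EuclideanSpace ℝ ι) (n : ℕ) :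
    ∫ ξ : ι → ℝ, (∑ i, x i * ξ i) ^ n ∂(Measure.pi fun _ => gaussianReal 0 1) =
      ‖x‖ ^ n * ∫ t, t ^ n ∂gaussianReal 0 1 := by
  have hL : (stdGaussian (EuclideanSpace ℝ ι)).map (innerSL ℝ x) =
      (gaussianReal 0 1).map (‖x‖ * ·) := by
    rw [IsGaussian.map_eq_gaussianReal, gaussianReal_map_const_mul, gaussianReal_ext_iff]
    refine ⟨by rw [integral_strongDual_stdGaussian, mul_zero], ?_⟩
    rw [variance_dual_stdGaussian, innerSL_apply_norm]
    ext
    simp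
  have h : ∫ ξ : ι → ℝ, (∑ i, x i * ξ i) ^ n ∂(Measure.pi fun _ => gaussianReal 0 1) =
      ∫ y, (innerSL ℝ x y) ^ n ∂(stdGaussian (EuclideanSpace ℝ ι)) := by
    rw [← map_pi_eq_stdGaussian, integral_map (by fun_prop)
      (Continuous.aestronglyMeasurable (by fun_prop))]
    simp [PiLp.inner_apply, mul_comm]
  rw [h, ← integral_map (φ := innerSL ℝ x) (f := fun t : ℝ => t ^ n) (by fun_prop)
    (Continuous.aestronglyMeasurable (by fun_prop)), hL,
    integral_map (by fun_prop) (Continuous.aestronglyMeasurable (by fun_prop))]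
  simp_rw [mul_pow]
  exact integral_const_mul _ _

theorem integrable_pow_gaussianReal (n : ℕ) :
    Integrable (fun t : ℝ => t ^ n) (gaussianReal 0 1) := by
  have h := (memLp_id_gaussianReal (μ := 0) (v := 1) n).integrable_norm_pow'
  refine h.mono (Continuous.aestronglyMeasurable (by fun_prop)) ?_
  simp

instance isOpenPosMeasure_gaussianReal : (gaussianReal 0 1).IsOpenPosMeasure :=
  (gaussianReal_absolutelyContinuous' 0 one_ne_zero).isOpenPosMeasure

theorem integral_pow_two_mul_gaussianReal_pos (r : ℕ) :
    0 < ∫ t, t ^ (2 * r) ∂gaussianReal 0 1 := by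
  rw [integral_pos_iff_support_of_nonneg (fun t => (even_two_mul r).pow_nonneg t)
    (integrable_pow_gaussianReal _)]
  refine IsOpen.measure_pos _ (Continuous.isOpen_support (by fun_prop)) ⟨1, by simp⟩

/-- The moment curve `t ↦ (t, t², …, t^m)`. -/
def momentCurve (m : ℕ) (t : ℝ) : Fin m → ℝ := fun j => t ^ (j.1 + 1)

theorem continuous_momentCurve (m : ℕ) : Continuous (momentCurve m) := by
  unfold momentCurve
  fun_prop

theorem momentCurve_zero (m : ℕ) : momentCurve m 0 = 0 := by
  ext j
  simp [momentCurve]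

/-- The power sum map is open at points with distinct coordinates. -/
theorem map_nhds_sum_momentCurve {m : ℕ} {z : Fin m → ℝ} (hz : Function.Injective z) :
    map (fun y : Fin m → ℝ => ∑ i, momentCurve m (y i)) (𝓝 z) =
      𝓝 (∑ i, momentCurve m (z i)) := by
  let D : (Fin m → ℝ) →L[ℝ] (Fin m → ℝ) := ContinuousLinearMap.pi fun j =>
    ∑ i, ((j.1 + 1 : ℝ) * z i ^ j.1) • ContinuousLinearMap.proj i
  have hD : HasStrictFDerivAt (fun y : Fin m → ℝ => ∑ i, momentCurve m (y i)) D z := by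
    rw [hasStrictFDerivAt_pi']
    intro j
    have h : HasStrictFDerivAt (fun y : Fin m → ℝ => ∑ i, (y i) ^ (j.1 + 1))
        (∑ i, ((j.1 + 1 : ℝ) * z i ^ j.1) •
          (ContinuousLinearMap.proj i : (Fin m → ℝ) →L[ℝ] ℝ)) z := by
      refine HasStrictFDerivAt.fun_sum fun i _ => ?_
      have h1 := (hasStrictFDerivAt_apply (𝕜 := ℝ) i z).pow (j.1 + 1)
      simpa using h1
    have hfun : (fun y : Fin m → ℝ => (∑ i, momentCurve m (y i)) j) =
        fun y => ∑ i, (y i) ^ (j.1 + 1) := by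
      ext y
      simp [momentCurve]
    rw [hfun]
    exact h
  refine hD.map_nhds_eq_of_surj ?_
  rw [LinearMap.range_eq_top]
  refine (LinearMap.injective_iff_surjective (f := (D : (Fin m → ℝ) →ₗ[ℝ] Fin m → ℝ))).1 ?_
  rw [injective_iff_map_eq_zero]
  intro y hy
  have hdet : (Matrix.vandermonde z).transpose.det ≠ 0 := by
    rw [Matrix.det_transpose]
    exact Matrix.det_vandermonde_ne_zero_iff.2 hz
  refine Matrix.eq_zero_of_mulVec_eq_zero hdet ?_
  ext j
  have hj := congrFun hy j
  have hj' : (j.1 + 1 : ℝ) * ∑ i, z i ^ j.1 * y i = 0 := by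
    simpa [D, Finset.mul_sum, mul_assoc] using hj
  simpa [Matrix.mulVec, dotProduct, Matrix.vandermonde_apply] using
    (mul_eq_zero.1 hj').resolve_left (by positivity)

theorem smul_sum_momentCurve_mem_convexHull {m : ℕ} (hm : 0 < m) (z : Fin m → ℝ) :
    (m : ℝ)⁻¹ • ∑ i, momentCurve m (z i) ∈ convexHull ℝ (Set.range (momentCurve m)) := by
  rw [Finset.smul_sum]
  refine (convex_convexHull ℝ _).sum_mem (fun _ _ => by positivity) ?_
    fun i _ => subset_convexHull _ _ ⟨_, rfl⟩
  simp [hm.ne']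

theorem interior_convexHull_momentCurve_nonempty {m : ℕ} (hm : 0 < m) :
    (interior (convexHull ℝ (Set.range (momentCurve m)))).Nonempty := by
  let z : Fin m → ℝ := fun i => i.1
  have hz : Function.Injective z := fun i j h => Fin.ext (by simpa [z] using h)
  have h : map (fun y : Fin m → ℝ => (m : ℝ)⁻¹ • ∑ i, momentCurve m (y i)) (𝓝 z) =
      𝓝 ((m : ℝ)⁻¹ • ∑ i, momentCurve m (z i)) := by
    change map ((fun y => (m : ℝ)⁻¹ • y) ∘ fun y : Fin m → ℝ => ∑ i, momentCurve m (y i)) _ = _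
    rw [← map_map, map_nhds_sum_momentCurve hz]
    exact (Homeomorph.smulOfNeZero (m : ℝ)⁻¹ (by positivity)).map_nhds_eq _
  refine ⟨(m : ℝ)⁻¹ • ∑ i, momentCurve m (z i), mem_interior_iff_mem_nhds.2 ?_⟩
  rw [← h]
  exact mem_map.2 <| Filter.univ_mem' fun y => smul_sum_momentCurve_mem_convexHull hm y

/-- The moment vector of a measure of full support is interior to the moment space. -/
theorem moments_mem_interior_convexHull {m : ℕ} (hm : 0 < m) (μ : Measure ℝ)
    [IsProbabilityMeasure μ] [μ.IsOpenPosMeasure] (hμ : ∀ n : ℕ, Integrable (fun t => t ^ n) μ) :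
    (fun j : Fin m => ∫ t, t ^ (j.1 + 1) ∂μ) ∈
      interior (convexHull ℝ (Set.range (momentCurve m))) := by
  by_contra hγ
  set γ : Fin m → ℝ := fun j => ∫ t, t ^ (j.1 + 1) ∂μ
  set C := convexHull ℝ (Set.range (momentCurve m))
  have hC : Convex ℝ C := convex_convexHull ℝ _
  have hne := interior_convexHull_momentCurve_nonempty hm
  obtain ⟨f, hf⟩ := geometric_hahn_banach_open_point hC.interior isOpen_interior hγ
  have hle : ∀ a ∈ C, f a ≤ f γ := by
    intro a ha
    apply closure_minimal (fun x hx => le_of_lt (hf x hx)) <| isClosed_Iic.preimage f.continuous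
    simpa [hC.closure_interior_eq_closure_of_nonempty_interior hne] using subset_closure ha
  have hint : Integrable (momentCurve m) μ := Integrable.of_eval fun j => hμ _
  have hγ' : γ = ∫ t, momentCurve m t ∂μ := by
    ext j
    exact (eval_integral (fun j => hμ (j.1 + 1)) j).symm
  have hfint : Integrable (fun t => f γ - f (momentCurve m t)) μ :=
    (integrable_const _).sub (f.integrable_comp hint)
  have hzero : ∫ t, (f γ - f (momentCurve m t)) ∂μ = 0 := by
    rw [integral_sub (integrable_const _) (f.integrable_comp hint),
      f.integral_comp_comm hint, ← hγ']
    simp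
  have hae := (integral_eq_zero_iff_of_nonneg
    (fun t => sub_nonneg.2 (hle _ (subset_convexHull ℝ _ ⟨t, rfl⟩))) hfint).1 hzero
  have hcont : Continuous fun t => f γ - f (momentCurve m t) :=
    continuous_const.sub (f.continuous.comp (continuous_momentCurve m))
  have heq := (hcont.ae_eq_iff_eq μ continuous_zero).1 hae
  have hval : ∀ t, f (momentCurve m t) = f γ := fun t => (sub_eq_zero.1 (congrFun heq t)).symm
  have hγ0 : f γ = 0 := by
    rw [← hval 0, momentCurve_zero, map_zero]
  have hC0 : C ⊆ {a | f a = 0} := by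
    refine convexHull_min ?_ ?_
    · rintro _ ⟨t, rfl⟩
      exact (hval t).trans hγ0
    · exact (LinearMap.ker (f : (Fin m → ℝ) →ₗ[ℝ] ℝ)).convex
  obtain ⟨a, ha⟩ := hne
  have h1 : f a = 0 := hC0 (interior_subset ha)
  have h2 := hf a ha
  rw [h1, hγ0] at h2
  exact lt_irrefl _ h2

/-- An interior point of the moment space is a combination of points of the moment curve
in which `m` prescribed points have the same positive weight. -/
theorem exists_weights_of_mem_interior {m : ℕ} (hm : 0 < m) {γ : Fin m → ℝ}
    (hγ : γ ∈ interior (convexHull ℝ (Set.range (momentCurve m)))) (z : Fin m → ℝ) :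
    ∃ (ι : Type) (_ : Fintype ι) (w : ι → ℝ) (y : ι → ℝ) (w' : ℝ), (∀ i, 0 ≤ w i) ∧ 0 < w' ∧
      ∑ i, w i + m * w' = 1 ∧
      ∑ i, w i • momentCurve m (y i) + w' • ∑ i, momentCurve m (z i) = γ := by
  set u : Fin m → ℝ := (m : ℝ)⁻¹ • ∑ i, momentCurve m (z i) with hu
  have hcont : Tendsto (fun s : ℝ => γ + s • (γ - u)) (𝓝[>] 0) (𝓝 γ) := by
    have : Continuous fun s : ℝ => γ + s • (γ - u) := by fun_prop
    simpa using (this.tendsto 0).mono_left nhdsWithin_le_nhds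
  obtain ⟨s, hs, hs0⟩ := ((hcont.eventually (mem_interior_iff_mem_nhds.1 hγ)).and
    self_mem_nhdsWithin).exists
  have hs0 : 0 < s := hs0
  have hm' : (m : ℝ) ≠ 0 := by positivity
  obtain ⟨ι, _, w, a, hw, hw1, ha, hsum⟩ := mem_convexHull_iff_exists_fintype.1 hs
  choose y hy using ha
  refine ⟨ι, inferInstance, fun i => (1 + s)⁻¹ * w i, y, (1 + s)⁻¹ * s * (m : ℝ)⁻¹,
    fun i => mul_nonneg (by positivity) (hw i), by positivity, ?_, ?_⟩
  · rw [← Finset.mul_sum, hw1]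
    field_simp
  · simp_rw [mul_smul, ← Finset.smul_sum, hy, hsum, ← hu, ← smul_add]
    rw [show γ + s • (γ - u) + s • u = (1 + s) • γ by module, smul_smul,
      inv_mul_cancel₀ (by positivity), one_smul]

/-- A sum over points with multiplicities, filled up with zeros, as a sum over `Fin n`. -/
theorem exists_fin_sum_momentCurve {m : ℕ} {ι : Type*} [Fintype ι] (k : ι → ℕ) (y : ι → ℝ)
    (k' : ℕ) (z : Fin m → ℝ) {n : ℕ} (hn : ∑ i, k i + m * k' ≤ n) :
    ∃ t : Fin n → ℝ, ∑ l, momentCurve m (t l) =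
      ∑ i, (k i : ℝ) • momentCurve m (y i) + (k' : ℝ) • ∑ i, momentCurve m (z i) := by
  have hcard : Fintype.card (((Σ i, Fin (k i)) ⊕ (Fin m × Fin k')) ⊕
      Fin (n - (∑ i, k i + m * k'))) = n := by
    simp
    omega
  let e := (Fintype.equivFinOfCardEq hcard).symm
  let t : ((Σ i, Fin (k i)) ⊕ (Fin m × Fin k')) ⊕ Fin (n - (∑ i, k i + m * k')) → ℝ :=
    Sum.elim (Sum.elim (fun a => y a.1) fun a => z a.1) fun _ => 0
  refine ⟨fun l => t (e l), ?_⟩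
  rw [e.sum_comp fun l => momentCurve m (t l)]
  simp [t, Fintype.sum_sum_type, Fintype.sum_sigma, Fintype.sum_prod_type, momentCurve_zero,
    Finset.smul_sum, Nat.cast_smul_eq_nsmul]

/-- An interior point of the moment space is the average of `n` points of the moment curve, for
every large `n`. -/
theorem eventually_exists_average_momentCurve {m : ℕ} (hm : 0 < m) {γ : Fin m → ℝ}
    (hγ : γ ∈ interior (convexHull ℝ (Set.range (momentCurve m)))) :
    ∀ᶠ n : ℕ in atTop, ∃ t : Fin n → ℝ, ∑ l, momentCurve m (t l) = (n : ℝ) • γ := by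
  let z : Fin m → ℝ := fun i => i.1
  have hz : Function.Injective z := fun i j h => Fin.ext (by simpa [z] using h)
  obtain ⟨ι, _, w, y, w', hw, hw', hw1, hsum⟩ := exists_weights_of_mem_interior hm hγ z
  have hfl : ∀ a : ℝ, 0 ≤ a → Tendsto (fun n : ℕ => (⌊a * n⌋₊ : ℝ) / n) atTop (𝓝 a) :=
    fun a ha => (tendsto_nat_floor_mul_div_atTop ha).comp tendsto_natCast_atTop_atTop
  have hT : Tendsto (fun n : ℕ => ((⌊w' * n⌋₊ : ℝ) / n)⁻¹ •
      (γ - ∑ i, ((⌊w i * n⌋₊ : ℝ) / n) • momentCurve m (y i))) atTop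
      (𝓝 (∑ i, momentCurve m (z i))) := by
    have h : Tendsto (fun n : ℕ => ((⌊w' * n⌋₊ : ℝ) / n)⁻¹ •
        (γ - ∑ i, ((⌊w i * n⌋₊ : ℝ) / n) • momentCurve m (y i))) atTop
        (𝓝 (w'⁻¹ • (γ - ∑ i, w i • momentCurve m (y i)))) :=
      ((hfl w' hw'.le).inv₀ hw'.ne').smul (tendsto_const_nhds.sub
        (tendsto_finsetSum _ fun i _ => (hfl (w i) (hw i)).smul tendsto_const_nhds))
    have hlim : w'⁻¹ • (γ - ∑ i, w i • momentCurve m (y i)) = ∑ i, momentCurve m (z i) := by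
      rw [← hsum, add_sub_cancel_left, smul_smul, inv_mul_cancel₀ hw'.ne', one_smul]
    rwa [hlim] at h
  rw [← map_nhds_sum_momentCurve hz] at hT
  have hrange := hT.eventually (range_mem_map (f := 𝓝 z))
  filter_upwards [hrange, (hfl w' hw'.le).eventually (lt_mem_nhds hw'), eventually_gt_atTop 0]
    with n ⟨z', hz'⟩ hpos hn
  have hn' : (n : ℝ) ≠ 0 := by positivity
  have hle : ∑ i, ⌊w i * n⌋₊ + m * ⌊w' * n⌋₊ ≤ n := by
    have h1 : (∑ i, (⌊w i * n⌋₊ : ℝ)) + m * (⌊w' * n⌋₊ : ℝ) ≤ ∑ i, w i * n + m * (w' * n) := by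
      gcongr with i
      · exact Nat.floor_le (mul_nonneg (hw i) n.cast_nonneg)
      · exact Nat.floor_le (by positivity)
    have h2 : ∑ i, w i * n + m * (w' * n) = n := by
      rw [← Finset.sum_mul, ← mul_assoc, ← add_mul, hw1, one_mul]
    rw [h2] at h1
    exact_mod_cast h1
  obtain ⟨t, ht⟩ := exists_fin_sum_momentCurve (fun i => ⌊w i * n⌋₊) y ⌊w' * n⌋₊ z' hle
  refine ⟨t, ht.trans ?_⟩
  have hk : (⌊w' * n⌋₊ : ℝ) = n * ((⌊w' * n⌋₊ : ℝ) / n) := by field_simp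
  have hki : ∀ i, (⌊w i * n⌋₊ : ℝ) = n * ((⌊w i * n⌋₊ : ℝ) / n) := fun i => by field_simp
  have hz'' : ((⌊w' * n⌋₊ : ℝ) / n) • ∑ i, momentCurve m (z' i) =
      γ - ∑ i, ((⌊w i * n⌋₊ : ℝ) / n) • momentCurve m (y i) := by
    rw [hz', smul_smul, mul_inv_cancel₀ hpos.ne', one_smul]
  rw [hk, mul_smul, hz'']
  simp_rw [fun i => congrArg (· • momentCurve m (y i)) (hki i), mul_smul, ← Finset.smul_sum]
  rw [← smul_add, add_sub_cancel]

/-- For every large `n` there are `n` equally weighted real points whose moments up to order `m`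
are those of the standard Gaussian measure. -/
theorem eventually_exists_gaussian_design (m : ℕ) (hm : 0 < m) :
    ∀ᶠ n : ℕ in atTop, ∃ t : Fin n → ℝ, ∀ k ≤ m,
      ∑ l, t l ^ k = n * ∫ x, x ^ k ∂gaussianReal 0 1 := by
  filter_upwards [eventually_exists_average_momentCurve hm
    (moments_mem_interior_convexHull hm (gaussianReal 0 1) integrable_pow_gaussianReal)]
    with n ⟨t, ht⟩
  refine ⟨t, fun k hk => ?_⟩
  obtain _ | k := k
  · simp
  · simpa [momentCurve] using congrFun ht ⟨k, hk⟩

/-- The rows `c ρ` form an orthogonal array of strength `s`: on at most `s` columns, all patterns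
occur equally often. -/
def IsOrthogonalArray {R ι A : Type*} (s : ℕ) (c : R → ι → A) : Prop :=
  ∀ S : Finset ι, S.card ≤ s → ∃ k : ℕ, ∀ b : S → A, Nat.card {ρ // ∀ i : S, c ρ i = b i} = k

theorem IsOrthogonalArray.card_pow_mul_sum {R ι A : Type*} [DecidableEq ι] [Fintype R]
    [Fintype A] {s : ℕ}
    {c : R → ι → A} (hc : IsOrthogonalArray s c) {S : Finset ι} (hS : S.card ≤ s)
    (g : (S → A) → ℝ) :
    (Fintype.card A : ℝ) ^ S.card * ∑ ρ, g (fun i => c ρ i) = Fintype.card R * ∑ b, g b := by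
  classical
  obtain ⟨k, hk⟩ := hc S hS
  have hsum : ∀ g : (S → A) → ℝ, ∑ ρ, g (fun i => c ρ i) = k * ∑ b, g b := by
    intro g
    rw [← Finset.sum_fiberwise (s := Finset.univ) (g := fun ρ (i : S) => c ρ i), Finset.mul_sum]
    refine Finset.sum_congr rfl fun b _ => ?_
    rw [Finset.sum_congr rfl (g := fun _ => g b)
      (fun ρ hρ => by rw [(Finset.mem_filter.1 hρ).2]), Finset.sum_const, nsmul_eq_mul, ← hk b,
      Nat.card_eq_fintype_card, Fintype.card_subtype]
    simp [funext_iff]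
  have h1 : (Fintype.card R : ℝ) = k * (Fintype.card A : ℝ) ^ S.card := by
    simpa using hsum fun _ => 1
  rw [hsum, h1]
  ring

/-- Polynomials of degree less than `s` over a finite field, projected to an additive quotient,
form an orthogonal array of strength `s`. -/
theorem isOrthogonalArray_polynomial {F A ι : Type*} [Field F] [Fintype F] [AddCommGroup A]
    [Fintype A] (φ : F →+ A) (hφ : Function.Surjective φ) {pt : ι → F}
    (hpt : Function.Injective pt) (s : ℕ) :
    IsOrthogonalArray (s + 1) fun (ρ : A × (Fin s → F)) i =>
      ρ.1 + φ (∑ j, ρ.2 j * pt i ^ (j.1 + 1)) := by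
  classical
  intro S hS
  let ψ : A × (Fin s → F) →+ (S → A) :=
    { toFun := fun ρ i => ρ.1 + φ (∑ j, ρ.2 j * pt i ^ (j.1 + 1))
      map_zero' := by
        ext
        simp
      map_add' := fun ρ σ => by
        ext
        simp only [Prod.fst_add, Prod.snd_add, Pi.add_apply, add_mul, Finset.sum_add_distrib,
          map_add]
        abel }
  have hψ : Function.Surjective ψ := by
    intro b
    choose e he using fun i => hφ (b i)
    let v : S → F := fun i => pt i
    have hv : Set.InjOn v (Finset.univ : Finset S) := fun i _ j _ h => Subtype.ext (hpt h)
    let P := Lagrange.interpolate Finset.univ v e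
    have hdeg : P.natDegree < s + 1 := by
      rcases eq_or_ne P 0 with h | h
      · simp [h]
      · rw [Polynomial.natDegree_lt_iff_degree_lt h]
        refine (Lagrange.degree_interpolate_lt e hv).trans_le ?_
        rw [Finset.card_univ, Fintype.card_coe]
        exact_mod_cast hS
    refine ⟨(φ (P.coeff 0), fun j => P.coeff (j.1 + 1)), ?_⟩
    ext i
    have hP : P.eval (v i) = e i := Lagrange.eval_interpolate_at_node e hv (Finset.mem_univ i)
    rw [Polynomial.eval_eq_sum_range' hdeg, Finset.sum_range_succ', Finset.sum_range] at hP
    change φ _ + φ _ = _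
    rw [← map_add, ← he i, ← hP, add_comm]
    simp [v]
  refine ⟨Nat.card {ρ // ψ ρ = 0}, fun b => ?_⟩
  have h := AddMonoidHom.card_fiber_eq_of_mem_range ψ (hψ b) (hψ 0)
  simp only [Nat.card_eq_fintype_card, Fintype.card_subtype, ← h]
  congr 1
  ext ρ
  simp [ψ, funext_iff]

theorem exists_isOrthogonalArray {q : ℕ} (hq : IsPrimePow q) {m : ℕ} (hm : 0 < m) {d : ℕ}
    (hd : d ≤ q ^ m) (s : ℕ) :
    ∃ (R A : Type) (_ : Fintype R) (_ : Fintype A) (c : R → Fin d → A),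
      Fintype.card R = q * (q ^ m) ^ s ∧ Fintype.card A = q ∧ IsOrthogonalArray (s + 1) c := by
  obtain ⟨p, e, hp, he, rfl⟩ := hq
  have : Fact p.Prime := ⟨hp.nat_prime⟩
  have hem : e * m ≠ 0 := (Nat.mul_pos he hm).ne'
  let F := GaloisField p (e * m)
  let : Fintype F := Fintype.ofFinite F
  have hF : Fintype.card F = (p ^ e) ^ m := by
    rw [← Nat.card_eq_fintype_card, GaloisField.card p _ hem, pow_mul]
  let L : F ≃ₗ[ZMod p] (Fin (e * m) → ZMod p) :=
    LinearEquiv.ofFinrankEq _ _ (by rw [GaloisField.finrank p hem, Module.finrank_fin_fun])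
  let φ : F →ₗ[ZMod p] (Fin e → ZMod p) :=
    LinearMap.funLeft (ZMod p) (ZMod p) (Fin.castLE (Nat.le_mul_of_pos_right e hm)) ∘ₗ
      (L : F →ₗ[ZMod p] _)
  have hφ : Function.Surjective φ := by
    rw [LinearMap.coe_comp]
    exact (LinearMap.funLeft_surjective_of_injective _ _ _ (Fin.castLE_injective _)).comp L.surjective
  obtain ⟨pt⟩ : Nonempty (Fin d ↪ F) :=
    Function.Embedding.nonempty_of_card_le (by rw [Fintype.card_fin, hF]; exact hd)
  refine ⟨(Fin e → ZMod p) × (Fin s → F), Fin e → ZMod p, inferInstance, inferInstance, _, ?_, ?_,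
    isOrthogonalArray_polynomial φ.toAddMonoidHom hφ pt.injective s⟩
  · simp [hF, ZMod.card]
  · simp [ZMod.card]

/-- If the letters of an orthogonal array of strength `s` are given real values with Gaussian
moments, then the rows have the Gaussian mixed moments of order `s`. -/
theorem IsOrthogonalArray.sum_prod {R ι A : Type*} [Fintype R] [Fintype A] [Nonempty A]
    [Fintype ι] {s : ℕ} {c : R → ι → A} (hc : IsOrthogonalArray s c) (t : A → ℝ)
    (ht : ∀ k ≤ s, ∑ a, t a ^ k = Fintype.card A * ∫ x, x ^ k ∂gaussianReal 0 1)
    (f : Fin s → ι) :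
    ∑ ρ, ∏ j, t (c ρ (f j)) = Fintype.card R *
      ∫ ξ : ι → ℝ, ∏ j, ξ (f j) ∂(Measure.pi fun _ => gaussianReal 0 1) := by
  classical
  let S : Finset ι := Finset.univ.image f
  let k : ι → ℕ := fun i => (Finset.univ.filter fun j => f j = i).card
  have hS : S.card ≤ s := Finset.card_image_le.trans (by simp)
  have hk : ∀ i, k i ≤ s := fun i => (Finset.card_le_univ _).trans (by simp)
  have hprod : ∀ y : ι → ℝ, ∏ j, y (f j) = ∏ i : S, y i ^ k i := by
    intro y
    rw [Finset.prod_comp, ← Finset.prod_coe_sort]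
  have hk0 : ∀ i ∉ S, k i = 0 := by
    intro i hi
    simp only [S, Finset.mem_image, Finset.mem_univ, true_and, not_exists] at hi
    simpa [k, Finset.filter_eq_empty_iff] using hi
  have hgauss : ∫ ξ : ι → ℝ, ∏ j, ξ (f j) ∂(Measure.pi fun _ => gaussianReal 0 1) =
      ∏ i : S, ∫ x, x ^ k i ∂gaussianReal 0 1 := by
    have h1 : ∀ ξ : ι → ℝ, ∏ j, ξ (f j) = ∏ i, ξ i ^ k i := fun ξ => by
      rw [hprod, Finset.prod_coe_sort S fun i => ξ i ^ k i]
      exact Finset.prod_subset (Finset.subset_univ _) fun i _ hi => by rw [hk0 i hi, pow_zero]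
    simp_rw [h1]
    rw [integral_fintype_prod_eq_prod fun i x => x ^ k i,
      Finset.prod_coe_sort S fun i => ∫ x, x ^ k i ∂gaussianReal 0 1]
    exact (Finset.prod_subset (Finset.subset_univ _) fun i _ hi => by simp [hk0 i hi]).symm
  have h := hc.card_pow_mul_sum hS fun b => ∏ i : S, t (b i) ^ k i
  rw [← Fintype.piFinset_univ, ← Finset.prod_univ_sum (fun _ => Finset.univ)
    fun (i : S) a => t a ^ k i] at h
  simp_rw [ht _ (hk _)] at h
  rw [Finset.prod_mul_distrib, Finset.prod_const, Finset.card_univ, Fintype.card_coe] at h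
  rw [hgauss]
  simp_rw [fun ρ => hprod fun i => t (c ρ i)]
  have hA : (Fintype.card A : ℝ) ^ S.card ≠ 0 := pow_ne_zero _ (by simp)
  refine mul_left_cancel₀ hA (h.trans ?_)
  ring

theorem IsOrthogonalArray.sum_linearForm_pow {R ι A : Type*} [Fintype R] [Fintype A] [Nonempty A]
    [Fintype ι] {s : ℕ} {c : R → ι → A} (hc : IsOrthogonalArray s c) (t : A → ℝ)
    (ht : ∀ k ≤ s, ∑ a, t a ^ k = Fintype.card A * ∫ x, x ^ k ∂gaussianReal 0 1)
    (x : EuclideanSpace ℝ ι) :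
    ∑ ρ, (∑ i, x i * t (c ρ i)) ^ s = Fintype.card R *
      (‖x‖ ^ s * ∫ y, y ^ s ∂gaussianReal 0 1) := by
  classical
  have hint : ∀ f : Fin s → ι, Integrable (fun ξ : ι → ℝ => ∏ j, ξ (f j))
      (Measure.pi fun _ => gaussianReal 0 1) := by
    intro f
    have h := Integrable.fintype_prod (ι := ι) (𝕜 := ℝ) (μ := fun _ => gaussianReal 0 1)
      (f := fun i x => x ^ (Finset.univ.filter fun j => f j = i).card)
      fun i => integrable_pow_gaussianReal _
    refine h.congr (Eventually.of_forall fun ξ => ?_)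
    dsimp only
    rw [← Finset.prod_fiberwise' Finset.univ f ξ]
    simp
  rw [← integral_linearForm_pow_gaussian]
  simp_rw [Finset.sum_pow', Fintype.piFinset_univ, Finset.prod_mul_distrib]
  rw [Finset.sum_comm, integral_finsetSum _ fun f _ => (hint f).const_mul _, Finset.mul_sum]
  refine Finset.sum_congr rfl fun f _ => ?_
  rw [← Finset.mul_sum, hc.sum_prod t ht f, integral_const_mul]
  ring

/-- A linear map whose coordinates satisfy `∑ (ι x)_ρ ^ (2r) = C ‖x‖ ^ (2r)` yields an isometric
embedding after rescaling. -/
theorem embedsIsometrically_of_sum_pow {r : ℕ} (hr : 1 ≤ r) {d : ℕ} {R : Type*} [Fintype R]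
    (l : Ell 2 d →ₗ[ℝ] (R → ℝ)) {C : ℝ} (hC : 0 < C)
    (h : ∀ x, ∑ ρ, l x ρ ^ (2 * r) = C * ‖x‖ ^ (2 * r)) :
    EmbedsIsometrically r hr d (Fintype.card R) := by
  have : Fact (1 ≤ ((2 * r : ℕ) : ℝ≥0∞)) := fact_one_le_two_mul hr
  have hr0 : 2 * r ≠ 0 := by omega
  let e := (Fintype.equivFin R).symm
  let a : ℝ := C⁻¹ ^ ((2 * r : ℕ) : ℝ)⁻¹
  have ha : a ^ (2 * r) = C⁻¹ := Real.rpow_inv_natCast_pow (by positivity) hr0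
  refine ⟨⟨(WithLp.linearEquiv ((2 * r : ℕ) : ℝ≥0∞) ℝ
    (Fin (Fintype.card R) → ℝ)).symm.toLinearMap ∘ₗ LinearMap.funLeft ℝ ℝ e ∘ₗ (a • l), ?_⟩⟩
  intro x
  have hpow : ∑ i, (a * l x (e i)) ^ (2 * r) = ‖x‖ ^ (2 * r) := by
    rw [e.sum_comp fun ρ => (a * l x ρ) ^ (2 * r)]
    simp_rw [mul_pow]
    rw [← Finset.mul_sum, h, ha, ← mul_assoc, inv_mul_cancel₀ hC.ne', one_mul]
  have hpos : 0 < ((2 * r : ℕ) : ℝ≥0∞).toReal := by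
    rw [ENNReal.toReal_natCast]
    exact_mod_cast Nat.pos_of_ne_zero hr0
  rw [PiLp.norm_eq_sum hpos, ENNReal.toReal_natCast]
  have hterm : ∀ i, ‖a * l x (e i)‖ ^ ((2 * r : ℕ) : ℝ) = (a * l x (e i)) ^ (2 * r) := by
    intro i
    rw [Real.rpow_natCast, Real.norm_eq_abs, (even_two_mul r).pow_abs]
  change (∑ i, ‖a * l x (e i)‖ ^ ((2 * r : ℕ) : ℝ)) ^ (1 / ((2 * r : ℕ) : ℝ)) = ‖x‖
  simp_rw [hterm]
  rw [hpow, one_div, Real.pow_rpow_inv_natCast (norm_nonneg _) hr0]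

/-- An orthogonal array of strength `2r` on letters with Gaussian moments embeds `ℓ_2`
into `ℓ_{2r}`. -/
theorem IsOrthogonalArray.embedsIsometrically {r : ℕ} (hr : 1 ≤ r) {d : ℕ} {R A : Type*}
    [Fintype R] [Nonempty R] [Fintype A] [Nonempty A] {c : R → Fin d → A}
    (hc : IsOrthogonalArray (2 * r) c) (t : A → ℝ)
    (ht : ∀ k ≤ 2 * r, ∑ a, t a ^ k = Fintype.card A * ∫ x, x ^ k ∂gaussianReal 0 1) :
    EmbedsIsometrically r hr d (Fintype.card R) := by
  let l : Ell 2 d →ₗ[ℝ] (R → ℝ) :=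
    { toFun := fun x ρ => ∑ i, x i * t (c ρ i)
      map_add' := fun x y => by
        ext ρ
        simp [add_mul, Finset.sum_add_distrib]
      map_smul' := fun a x => by
        ext ρ
        simp [Finset.mul_sum, mul_assoc] }
  refine embedsIsometrically_of_sum_pow hr l (C := Fintype.card R *
    ∫ y, y ^ (2 * r) ∂gaussianReal 0 1) ?_ fun x => ?_
  · exact mul_pos (by exact_mod_cast Fintype.card_pos) (integral_pow_two_mul_gaussianReal_pos r)
  · exact (hc.sum_linearForm_pow t ht x).trans (by ring)

theorem corollary4p12 (r : ℕ) (hr : 1 ≤ r) :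
    ∃ M : ℕ, ∀ q : ℕ, IsPrimePow q → M ≤ q →
      ∃ N : ℕ → ℕ,
        (∀ d : ℕ, 2 * r ≤ d →
          N d ≤ q ^ (2 * r) * d ^ (2 * r - 1) ∧ EmbedsIsometrically r hr d (N d)) ∧
        (fun d : ℕ => (N d : ℝ)) =O[Filter.atTop] (fun d : ℕ => (d : ℝ) ^ (2 * r - 1)) := by
  obtain ⟨M, hM⟩ := eventually_atTop.1 (eventually_exists_gaussian_design (2 * r) (by omega))
  refine ⟨M, fun q hq hMq => ⟨fun d => q * (q ^ Nat.clog q d) ^ (2 * r - 1), ?_⟩⟩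
  obtain ⟨t, ht⟩ := hM q hMq
  have hq1 : 1 < q := hq.one_lt
  have hbound : ∀ d : ℕ, 2 * r ≤ d →
      q * (q ^ Nat.clog q d) ^ (2 * r - 1) ≤ q ^ (2 * r) * d ^ (2 * r - 1) := by
    intro d hd
    have hm : 0 < Nat.clog q d := Nat.clog_pos hq1 (by omega)
    have hlt : q ^ (Nat.clog q d - 1) < d := Nat.pow_pred_clog_lt_self hq1 (by omega)
    calc q * (q ^ Nat.clog q d) ^ (2 * r - 1)
        = q * (q * q ^ (Nat.clog q d - 1)) ^ (2 * r - 1) := by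
          rw [mul_pow_sub_one hm.ne']
      _ ≤ q * (q * d) ^ (2 * r - 1) := by gcongr
      _ = q ^ (2 * r) * d ^ (2 * r - 1) := by
          rw [mul_pow, ← mul_assoc, mul_pow_sub_one (by omega)]
  refine ⟨fun d hd => ⟨hbound d hd, ?_⟩, ?_⟩
  · obtain ⟨R, A, _, _, c, hR, hA, hc⟩ := exists_isOrthogonalArray hq
      (Nat.clog_pos hq1 (show 2 ≤ d by omega)) (Nat.le_pow_clog hq1 d) (2 * r - 1)
    rw [Nat.sub_add_cancel (by omega)] at hc
    have : Nonempty A := Fintype.card_pos_iff.1 (by omega)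
    have : Nonempty R := Fintype.card_pos_iff.1 (by rw [hR]; positivity)
    have h := hc.embedsIsometrically hr (fun a => t (Fintype.equivFinOfCardEq hA a)) fun k hk => by
      rw [(Fintype.equivFinOfCardEq hA).sum_comp fun i => t i ^ k, ht k hk, hA]
    rwa [hR] at h
  · refine Asymptotics.IsBigO.of_bound ((q : ℝ) ^ (2 * r)) ?_
    filter_upwards [eventually_ge_atTop (2 * r)] with d hd
    rw [Real.norm_of_nonneg (by positivity), Real.norm_of_nonneg (by positivity)]
    exact_mod_cast hbound d hd
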